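/- Let $\mathcal A$ be the variety of all $\Sigma$-algebras satisfying a set $E$ of equations, where $\Sigma$ is a (set-indexed) signature, with operation symbols of arbitrary, possibly infinite, arity and with empty algebras allowed. Let $H:\mathcal A\to\mathcal A$ be an endofunctor preserving (wide) intersections, i.e. multiple pullbacks of monomorphisms. A coalgebra is a morphism $a:A\to HA$ of $\mathcal A$. Its quotients are the coalgebra homomorphisms from it carried by strong epimorphisms of $\mathcal A$, its subcoalgebras are the coalgebra homomorphisms into it carried by monomorphisms of $\mathcal A$; they are proper if not invertible. A coalgebra is simple if it has no proper quotient. A pointed coalgebra $(A,a,x)$ is a coalgebra with an element $x\in A$; its morphisms are the coalgebra homomorphisms preserving the point, and it is well-pointed if (among pointed coalgebras) it has no proper quotient and no proper subobject. The well-pointed modification $\mathrm{wp}(A,a,x)$ is obtained by forming the simple quotient $e:(A,a)\to(\bar A,\bar a)$ and then the least subcoalgebra of $(\bar A,\bar a)$ containing $e(x)$, pointed by $e(x)$. Let $T$ be a set of representatives of all well-pointed coalgebras up to isomorphism. Then: 1. Every pointed coalgebra $(A,a,x)$ has a well-pointed modification, isomorphic to exactly one member of $T$. Hence every coalgebra $(A,a)$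 yields a function $a^+:A\to T$, $a^+(x)=\mathrm{wp}(A,a,x)$. 2. $T$ becomes a $\Sigma$-algebra as follows. For an $n$-ary $\sigma\in\Sigma$ and members $(A_i,a_i,x_i)$ $(i<n)$ of $T$, the coproduct $A=\coprod_{i<n}A_i$ exists in $\mathcal A$ and, with the unique structure $a:A\to HA$ making all injections $v_i:A_i\to A$ coalgebra homomorphisms, is the coproduct of the $(A_i,a_i)$ in the category of coalgebras; put $$\sigma^T\big((A_i,a_i,x_i)_{i<n}\big)=\mathrm{wp}\big(A,a,\sigma^A(v_i(x_i))_{i<n}\big).$$ This does not depend on the choice of the coproduct. 3. The $\Sigma$-algebra $T$ satisfies the equations $E$, i.e. lies in $\mathcal A$, and for every coalgebra $(A,a)$ the function $a^+:A\to T$ is a $\Sigma$-homomorphism. 4. The function $\tau:T\to HT$, $\tau(A,a,x)=Ha^+(a(x))$, is a $\Sigma$-homomorphism, and $(T,\tau)$ is a final coalgebra for $H$. -/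

import Mathlib

open CategoryTheory CategoryTheory.Limits

universe u v

/-! ### Varieties of algebras -/

/-- A signature: a set of operation symbols, each with an arity. Arities are arbitrary sets
(an `n`-ary symbol is one whose arity has `n` elements). -/
structure Signature where
  Op : Type u
  arity : Op → Type u

namespace Signature

/-- A `Σ`-algebra structure on a set (which may be empty). -/
structure Algebra (S : Signature.{u}) (A : Type u) where
  op : (σ : S.Op) → (S.arity σ → A) → A

/-- Terms over a set of variables. -/
inductive Term (S : Signature.{u}) (X : Type u) : Type u
  | var (x : X) : Term S X
  | app (σ : S.Op) (args : S.arity σ → Term S X) : Term S X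

/-- The value of a term in an algebra under an assignment of the variables. -/
def Term.eval {S : Signature.{u}} {X A : Type u} (α : S.Algebra A) (ρ : X → A) : S.Term X → A
  | .var x => ρ x
  | .app σ args => α.op σ (fun i => (args i).eval α ρ)

/-- An equation `lhs = rhs` between two terms over some set of variables. -/
structure Equation (S : Signature.{u}) where
  Var : Type u
  lhs : S.Term Var
  rhs : S.Term Var

/-- The algebra satisfies all equations of `E`. -/
def Algebra.Satisfies {S : Signature.{u}} {A : Type u} (α : S.Algebra A)
    (E : Set S.Equation) : Prop :=
  ∀ e ∈ E, ∀ ρ : e.Var → A, e.lhs.eval α ρ = e.rhs.eval α ρ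

end Signature

/-- The variety of all `Σ`-algebras that satisfy the equations `E`. -/
structure Variety {S : Signature.{u}} (E : Set S.Equation) where
  carrier : Type u
  alg : S.Algebra carrier
  sat : alg.Satisfies E

namespace Variety

variable {S : Signature.{u}} {E : Set S.Equation}

instance : CoeSort (Variety E) (Type u) := ⟨Variety.carrier⟩

/-- A `Σ`-homomorphism. -/
@[ext]
structure Hom (A B : Variety E) where
  toFun : A → B
  map_op : ∀ (σ : S.Op) (x : S.arity σ → A),
    toFun (A.alg.op σ x) = B.alg.op σ (fun i => toFun (x i))

instance (A B : Variety E) : FunLike (Hom A B) A B where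
  coe := Hom.toFun
  coe_injective := fun _ _ h => Hom.ext h

instance : Category (Variety E) where
  Hom := Hom
  id A := ⟨fun x => x, fun _ _ => rfl⟩
  comp f g := ⟨fun x => g.toFun (f.toFun x), fun σ x => by rw [f.map_op, g.map_op]⟩

instance : ConcreteCategory (Variety E) Hom where
  hom f := f
  ofHom f := f
  hom_ofHom _ := rfl
  ofHom_hom _ := rfl
  id_apply _ := rfl
  comp_apply _ _ _ := rfl

end Variety

/-! ### Coalgebras over a category -/

section Coalgebras

variable {C : Type v} [Category.{u} C]

/-- The functor preserves (wide) intersections, i.e. multiple pullbacks of monomorphisms. -/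
def PreservesIntersections (H : C ⥤ C) : Prop :=
  ∀ (I : Type u) (B : C) (A : I → C) (m : ∀ i, A i ⟶ B), (∀ i, Mono (m i)) →
    PreservesLimit (WidePullbackShape.wideCospan B A m) H

/-- A coalgebra is simple if it has no proper quotient. Quotients are the homomorphisms carried by
strong epimorphisms of the base category. -/
def IsSimpleCoalgebra {H : C ⥤ C} (A : Endofunctor.Coalgebra H) : Prop :=
  ∀ (B : Endofunctor.Coalgebra H) (e : A ⟶ B), StrongEpi e.f → IsIso e

/-- `e` exhibits `B` as the simple quotient of `A`. -/
def IsSimpleQuotient {H : C ⥤ C} {A B : Endofunctor.Coalgebra H} (e : A ⟶ B) : Prop :=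
  StrongEpi e.f ∧ IsSimpleCoalgebra B

/-- For a coproduct `c` in the base category of the carriers of coalgebras `A i`: the object `c.pt`
with the unique coalgebra structure for which the injections are coalgebra homomorphisms. -/
def coproductCoalgebra {H : C ⥤ C} {I : Type u} (A : I → Endofunctor.Coalgebra H)
    (c : Cofan (fun i => (A i).V)) (hc : IsColimit c) : Cofan A :=
  Cofan.mk
    { V := c.pt
      str := Cofan.IsColimit.desc hc (fun i => (A i).str ≫ H.map (c.inj i)) }
    (fun i =>
      { f := c.inj i
        h := (Cofan.IsColimit.fac hc (fun i => (A i).str ≫ H.map (c.inj i)) i).symm })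

end Coalgebras

/-! ### Pointed and well-pointed coalgebras over a variety -/

section Pointed

variable {S : Signature.{u}} {E : Set S.Equation}

/-- A pointed coalgebra `(A, a, x)`: a coalgebra `a : A ⟶ H A` with an element `x` of `A`. -/
structure PointedCoalgebra (H : Variety E ⥤ Variety E) where
  coalg : Endofunctor.Coalgebra H
  point : coalg.V

namespace PointedCoalgebra

variable {H : Variety E ⥤ Variety E}

/-- Morphisms of pointed coalgebras: coalgebra homomorphisms preserving the point. -/
@[ext]
structure Hom (P Q : PointedCoalgebra H) where
  hom : P.coalg ⟶ Q.coalg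
  map_point : hom.f P.point = Q.point

instance : Category (PointedCoalgebra H) where
  Hom := Hom
  id P := ⟨𝟙 P.coalg, rfl⟩
  comp {P Q R} f g := ⟨f.hom ≫ g.hom, by
    change g.hom.f (f.hom.f P.point) = R.point
    rw [f.map_point, g.map_point]⟩

/-- No proper quotient and no proper subobject. Quotients are carried by strong epimorphisms and
subobjects by monomorphisms of the variety. -/
def IsWellPointed (P : PointedCoalgebra H) : Prop :=
  (∀ (Q : PointedCoalgebra H) (e : P ⟶ Q), StrongEpi e.hom.f → IsIso e) ∧
    ∀ (Q : PointedCoalgebra H) (m : Q ⟶ P), Mono m.hom.f → IsIso m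

/-- `m` exhibits `A` as the least subcoalgebra of `B` containing the element `y`. -/
def IsLeastSubcoalgebra {A B : Endofunctor.Coalgebra H} (m : A ⟶ B) (y : B.V) : Prop :=
  Mono m.f ∧ (∃ x : A.V, m.f x = y) ∧
    ∀ (A' : Endofunctor.Coalgebra H) (n : A' ⟶ B), Mono n.f → (∃ x : A'.V, n.f x = y) →
      ∃ g : A ⟶ A', g ≫ n = m

/-- `Q` is the well-pointed modification `wp(P)` of `P` (which is determined up to isomorphism):
the least subcoalgebra of the simple quotient of `P` that contains the image of the point,
pointed by that element. -/
def IsWellPointedModification (P Q : PointedCoalgebra H) : Prop :=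
  ∃ (B : Endofunctor.Coalgebra H) (e : P.coalg ⟶ B) (m : Q.coalg ⟶ B),
    IsSimpleQuotient e ∧ IsLeastSubcoalgebra m (e.f P.point) ∧ m.f Q.point = e.f P.point

/-- The family `rep`, indexed by the set `T`, contains precisely one representative of every
well-pointed coalgebra up to isomorphism. -/
def RepresentsWellPointed {T : Type u} (rep : T → PointedCoalgebra H) : Prop :=
  (∀ t, (rep t).IsWellPointed) ∧
    ∀ P : PointedCoalgebra H, P.IsWellPointed → ∃! t, Nonempty (P ≅ rep t)

end PointedCoalgebra

end Pointed

/-! Call elements of two coalgebras behaviourally equivalent if homomorphisms into a common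
coalgebra identify them. The modification `wp` picks the representative of each equivalence class.

In a variety, strong epimorphisms are the surjections and monomorphisms the injections. Since `H`
preserves intersections it preserves injections, so homomorphisms have coalgebra images and each
element lies in a least subcoalgebra. Simple quotients arise by dividing out everything that some
quotient identifies. A homomorphism into a simple coalgebra factors through every quotient of its
domain, and one out of a simple coalgebra is injective. Hence two well-pointed coalgebras whose
points meet in a common coalgebra embed in its simple quotient with the same point, and are
isomorphic (`IsWellPointedModification.eq_of_map_eq`). In particular `wp` is invariant under
homomorphisms (`wp_map`).

The rest is invariance plus coproducts. Members of `T` map into the simple quotient of any coalgebra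
containing equivalent elements, and copairing these maps makes every `a⁺` preserve operations
(`wp_coproduct_op`). Any family in `T` is the `a⁺`-image of a family in a single coalgebra, the
coproduct of the representatives, so `T` inherits the equations, and `τ` the homomorphism property
from `τ ∘ a⁺ = H a⁺ ∘ a` (`wpStrFun_wp`). That identity also makes `a⁺` a coalgebra homomorphism
into `T`. It is the only one, because the map `a⁺` of `T` itself is the identity. -/

open CategoryTheory CategoryTheory.Limits

/-! ### Presentations of algebras in a variety -/

namespace Signature

variable {S : Signature.{u}}

/-- Evaluation of terms commutes with functions preserving the operations. -/
theorem Term.eval_map {X A B : Type u} {α : S.Algebra A} {β : S.Algebra B} (f : A → B)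
    (hf : ∀ σ x, f (α.op σ x) = β.op σ (fun i => f (x i))) (ρ : X → A) (t : S.Term X) :
    f (t.eval α ρ) = t.eval β (fun x => f (ρ x)) := by
  induction t with
  | var x => rfl
  | app σ args ih =>
    simp only [Term.eval, hf]
    congr 1
    exact funext ih

/-- The algebra of terms over a set of variables. -/
def termAlgebra (S : Signature.{u}) (X : Type u) : S.Algebra (S.Term X) := ⟨Term.app⟩

/-- The least congruence on terms that contains `r` and all instances of the equations `E`. -/
inductive PresentedRel (E : Set S.Equation) {X : Type u} (r : S.Term X → S.Term X → Prop) :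
    S.Term X → S.Term X → Prop
  | of {s t} : r s t → PresentedRel E r s t
  | eqn (e : S.Equation) (he : e ∈ E) (ρ : e.Var → S.Term X) :
      PresentedRel E r (e.lhs.eval (termAlgebra S X) ρ) (e.rhs.eval (termAlgebra S X) ρ)
  | refl (t) : PresentedRel E r t t
  | symm {s t} : PresentedRel E r s t → PresentedRel E r t s
  | trans {s t w} : PresentedRel E r s t → PresentedRel E r t w → PresentedRel E r s w
  | app (σ : S.Op) (s t : S.arity σ → S.Term X) :
      (∀ i, PresentedRel E r (s i) (t i)) → PresentedRel E r (.app σ s) (.app σ t)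

/-- The congruence `PresentedRel` as a setoid. -/
def presentedSetoid (E : Set S.Equation) {X : Type u} (r : S.Term X → S.Term X → Prop) :
    Setoid (S.Term X) :=
  ⟨PresentedRel E r, .refl, .symm, .trans⟩

theorem presentedRel_out {E : Set S.Equation} {X : Type u} {r : S.Term X → S.Term X → Prop}
    (s : S.Term X) : PresentedRel E r (Quotient.mk (presentedSetoid E r) s).out s :=
  Quotient.exact (s := presentedSetoid E r) (Quotient.out_eq _)

end Signature

namespace Variety

open Signature

variable {S : Signature.{u}} {E : Set S.Equation} {A B D : Variety E}

theorem map_op (f : A ⟶ B) (σ : S.Op) (x : S.arity σ → A) :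
    f (A.alg.op σ x) = B.alg.op σ (fun i => f (x i)) :=
  Hom.map_op f σ x

theorem comp_apply (f : A ⟶ B) (g : B ⟶ D) (x : A) : (f ≫ g) x = g (f x) := rfl

theorem hom_ext {f g : A ⟶ B} (h : ∀ x, f x = g x) : f = g :=
  Hom.ext (funext h)

theorem congr_hom {f g : A ⟶ B} (h : f = g) (x : A) : f x = g x := by rw [h]

section Presented

variable {X : Type u} {r : S.Term X → S.Term X → Prop}

variable (E r) in
/-- The algebra of the variety presented by the generators `X` and the relations `r`. -/
noncomputable def presented : Variety E where
  carrier := Quotient (presentedSetoid E r)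
  -- Arities may be infinite, so representatives of all arguments are chosen at once; congruence
  -- makes the choice irrelevant.
  alg := ⟨fun σ x => Quotient.mk _ (.app σ (fun i => (x i).out))⟩
  sat e he ρ := by
    -- Representatives lift `ρ` to an assignment in terms, where the two sides of `e` are related by
    -- `PresentedRel.eqn`.
    have key (t : S.Term e.Var) :=
      Term.eval_map (α := termAlgebra S X)
        (β := ⟨fun σ x => Quotient.mk (presentedSetoid E r) (.app σ (fun i => (x i).out))⟩)
        (Quotient.mk (presentedSetoid E r))
        (fun _ _ => Quotient.sound (.app _ _ _ fun _ => .symm (presentedRel_out _)))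
        (fun v => (ρ v).out) t
    simp only [Quotient.out_eq] at key
    rw [← key, ← key]
    exact Quotient.sound (.eqn e he _)

variable (E r) in
/-- The canonical map from terms to the presented algebra. -/
def presentedMk (t : S.Term X) : presented E r := Quotient.mk (presentedSetoid E r) t

theorem presentedMk_surjective : Function.Surjective (presentedMk E r) := Quotient.mk_surjective

theorem presentedMk_app (σ : S.Op) (s : S.arity σ → S.Term X) :
    presentedMk E r (.app σ s) = (presented E r).alg.op σ (fun i => presentedMk E r (s i)) :=
  Quotient.sound (.app _ _ _ fun _ => .symm (presentedRel_out _))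

theorem presentedMk_rel {s t : S.Term X} (h : r s t) : presentedMk E r s = presentedMk E r t :=
  Quotient.sound (.of h)

theorem eval_eq_of_presentedRel (f : X → B)
    (hf : ∀ s t, r s t → s.eval B.alg f = t.eval B.alg f) {s t : S.Term X}
    (h : PresentedRel E r s t) : s.eval B.alg f = t.eval B.alg f := by
  induction h with
  | of h => exact hf _ _ h
  | eqn e he ρ =>
    have key := Term.eval_map (α := termAlgebra S X) (β := B.alg)
      (fun t : S.Term X => t.eval B.alg f) (fun _ _ => rfl) ρ
    exact (key _).trans ((B.sat e he _).trans (key _).symm)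
  | refl => rfl
  | symm _ ih => exact ih.symm
  | trans _ _ ih₁ ih₂ => exact ih₁.trans ih₂
  | app σ s t _ ih =>
    simp only [Term.eval]
    congr 1
    exact funext ih

/-- The homomorphism from a presented algebra given by an assignment of the generators that
satisfies the relations. -/
noncomputable def presentedDesc (f : X → B)
    (hf : ∀ s t, r s t → s.eval B.alg f = t.eval B.alg f) : presented E r ⟶ B where
  toFun := Quotient.lift (fun t => t.eval B.alg f) fun _ _ h => eval_eq_of_presentedRel f hf h
  map_op σ x := by
    change B.alg.op σ _ = _
    congr 1
    funext i
    conv_rhs => rw [← Quotient.out_eq (x i)]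
    rfl

theorem presented_hom_ext {f g : presented E r ⟶ B}
    (h : ∀ x, f (presentedMk E r (.var x)) = g (presentedMk E r (.var x))) : f = g := by
  refine hom_ext fun y => ?_
  obtain ⟨t, rfl⟩ := presentedMk_surjective y
  induction t with
  | var x => exact h x
  | app σ s ih =>
    rw [presentedMk_app, map_op, map_op]
    congr 1
    exact funext ih

end Presented

/-! ### Monomorphisms, strong epimorphisms, isomorphisms and images -/

/-- Elements are homomorphisms from the free algebra on one generator, which is presented by no
relations. -/
theorem injective_of_mono (f : A ⟶ B) [Mono f] : Function.Injective f := by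
  intro a b hab
  let F : Variety E := presented E (X := PUnit) (fun _ _ => False)
  have h : presentedDesc (r := fun _ _ => False) (fun _ : PUnit.{u + 1} => a) (by simp) ≫ f =
      presentedDesc (r := fun _ _ => False) (fun _ : PUnit.{u + 1} => b) (by simp) ≫ f :=
    presented_hom_ext fun _ => hab
  exact congr_hom ((cancel_mono f).1 h) (presentedMk E _ (.var PUnit.unit))

theorem mono_of_injective (f : A ⟶ B) (hf : Function.Injective f) : Mono f :=
  ⟨fun _ _ h => hom_ext fun x => hf (congr_hom h x)⟩

theorem epi_of_surjective (f : A ⟶ B) (hf : Function.Surjective f) : Epi f := by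
  refine ⟨fun g h w => hom_ext fun y => ?_⟩
  obtain ⟨x, rfl⟩ := hf y
  exact congr_hom w x

theorem isIso_of_bijective (f : A ⟶ B) (hf : Function.Bijective f) : IsIso f := by
  let g : B ⟶ A :=
    { toFun := (Equiv.ofBijective f hf).symm
      map_op := fun σ x => hf.1 <| by
        rw [map_op]
        simp only [Equiv.ofBijective_apply_symm_apply] }
  exact ⟨g, hom_ext fun x => (Equiv.ofBijective f hf).symm_apply_apply x,
    hom_ext fun x => (Equiv.ofBijective f hf).apply_symm_apply x⟩

/-- A homomorphism constant on the fibres of a surjective homomorphism factors through it. -/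
theorem exists_desc_of_surjective (q : A ⟶ B) (hq : Function.Surjective q) (f : A ⟶ D)
    (hf : ∀ x y, q x = q y → f x = f y) : ∃ g : B ⟶ D, q ≫ g = f := by
  have key (x : A) : f (Function.surjInv hq (q x)) = f x :=
    hf _ _ (Function.surjInv_eq hq _)
  refine ⟨⟨fun y => f (Function.surjInv hq y), fun σ x => ?_⟩, hom_ext key⟩
  have h : B.alg.op σ x = q (A.alg.op σ fun i => Function.surjInv hq (x i)) := by
    rw [map_op]
    simp only [Function.surjInv_eq]
  rw [h, key, map_op]

/-- A homomorphism with values in the image of an injective homomorphism factors through it. -/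
theorem exists_lift_of_injective (m : A ⟶ B) (hm : Function.Injective m) (f : D ⟶ B)
    (hf : ∀ z, ∃ x, m x = f z) : ∃ g : D ⟶ A, g ≫ m = f := by
  choose g hg using hf
  refine ⟨⟨g, fun σ x => hm ?_⟩, hom_ext hg⟩
  rw [hg, map_op, map_op]
  simp only [hg]

/-- The subalgebra carried by a subset closed under the operations. -/
def subalgebra (A : Variety E) (p : Set A) (hp : ∀ σ x, (∀ i, x i ∈ p) → A.alg.op σ x ∈ p) :
    Variety E where
  carrier := p
  alg := ⟨fun σ x => ⟨A.alg.op σ fun i => (x i).1, hp _ _ fun i => (x i).2⟩⟩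
  sat e he ρ := by
    have key (t : S.Term e.Var) :=
      Term.eval_map (β := A.alg)
        (α := ⟨fun σ x => ⟨A.alg.op σ fun i => (x i).1, hp _ _ fun i => (x i).2⟩⟩)
        (Subtype.val : p → A) (fun _ _ => rfl) ρ t
    exact Subtype.ext ((key _).trans ((A.sat e he _).trans (key _).symm))

/-- The inclusion of a subalgebra. -/
def subalgebraInclusion (A : Variety E) (p : Set A)
    (hp : ∀ σ x, (∀ i, x i ∈ p) → A.alg.op σ x ∈ p) : subalgebra A p hp ⟶ A :=
  ⟨Subtype.val, fun _ _ => rfl⟩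

/-- Every homomorphism is a surjective one followed by an injective one. -/
theorem exists_image (f : A ⟶ B) : ∃ (I : Variety E) (e : A ⟶ I) (m : I ⟶ B),
    Function.Surjective e ∧ Function.Injective m ∧ e ≫ m = f := by
  let p : Set B := Set.range f
  have hp (σ) (x : S.arity σ → B) (hx : ∀ i, x i ∈ p) : B.alg.op σ x ∈ p := by
    choose y hy using hx
    exact ⟨A.alg.op σ y, by rw [map_op]; simp only [hy]⟩
  have hinj : Function.Injective (subalgebraInclusion B p hp) := Subtype.val_injective
  obtain ⟨e, he⟩ := exists_lift_of_injective _ hinj f fun z => ⟨⟨f z, z, rfl⟩, rfl⟩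
  refine ⟨_, e, _, ?_, hinj, he⟩
  rintro ⟨_, a, rfl⟩
  exact ⟨a, hinj (congr_hom he a)⟩

theorem strongEpi_of_surjective (f : A ⟶ B) (hf : Function.Surjective f) : StrongEpi f := by
  have := epi_of_surjective f hf
  refine StrongEpi.mk' fun X Y z hz u v sq => ?_
  obtain ⟨l, hl⟩ := exists_desc_of_surjective f hf u fun x y hxy =>
    injective_of_mono z <| by
      rw [← comp_apply, ← comp_apply, sq.w, comp_apply, comp_apply, hxy]
  exact ⟨⟨⟨l, hl, (cancel_epi f).1 (by rw [← Category.assoc, hl, sq.w])⟩⟩⟩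

theorem surjective_of_isIso (f : A ⟶ B) [IsIso f] : Function.Surjective f :=
  fun y => ⟨inv f y, congr_hom (IsIso.inv_hom_id f) y⟩

theorem surjective_of_strongEpi (f : A ⟶ B) [StrongEpi f] : Function.Surjective f := by
  obtain ⟨I, e, m, he, hm, rfl⟩ := exists_image f
  have := mono_of_injective m hm
  have := strongEpi_of_strongEpi e m
  have := isIso_of_mono_of_strongEpi m
  exact (surjective_of_isIso m).comp he

/-! ### Quotients and coproducts -/

/-- The relations presenting the quotient of `A` by the congruence generated by `r`. -/
inductive QuotientRel (A : Variety E) (r : A → A → Prop) : S.Term A → S.Term A → Prop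
  | op (σ : S.Op) (x : S.arity σ → A) :
      QuotientRel A r (.var (A.alg.op σ x)) (.app σ fun i => .var (x i))
  | rel {x y : A} : r x y → QuotientRel A r (.var x) (.var y)

/-- The universal quotient of an algebra identifying the pairs related by `r`. -/
theorem exists_quotient (A : Variety E) (r : A → A → Prop) :
    ∃ (Q : Variety E) (q : A ⟶ Q), Function.Surjective q ∧ (∀ x y, r x y → q x = q y) ∧
      ∀ (B : Variety E) (f : A ⟶ B), (∀ x y, r x y → f x = f y) → ∃ g : Q ⟶ B, q ≫ g = f := by
  refine ⟨presented E (QuotientRel A r), ⟨fun x => presentedMk E _ (.var x), fun σ x => ?_⟩,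
    fun y => ?_, fun x y h => ?_, fun B f hf => ⟨presentedDesc f ?_, ?_⟩⟩
  · exact (presentedMk_rel (.op σ x)).trans (presentedMk_app _ _)
  · obtain ⟨t, rfl⟩ := presentedMk_surjective y
    induction t with
    | var x => exact ⟨x, rfl⟩
    | app σ s ih =>
      choose x hx using ih
      refine ⟨A.alg.op σ x, ?_⟩
      rw [map_op, presentedMk_app]
      simp only [hx]
  · exact presentedMk_rel (.rel h)
  · rintro _ _ (⟨σ, x⟩ | h)
    · exact map_op f σ x
    · exact hf _ _ h
  · exact hom_ext fun x => rfl

/-- The relations presenting the coproduct of a family of algebras. -/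
inductive CoproductRel {I : Type u} (A : I → Variety E) :
    S.Term (Σ i, A i) → S.Term (Σ i, A i) → Prop
  | op (i : I) (σ : S.Op) (x : S.arity σ → A i) :
      CoproductRel A (.var ⟨i, (A i).alg.op σ x⟩) (.app σ fun j => .var ⟨i, x j⟩)

/-- The coproduct of a family of algebras. -/
noncomputable def coproductCofan {I : Type u} (A : I → Variety E) : Cofan A :=
  Cofan.mk (presented E (CoproductRel A)) fun i =>
    ⟨fun x => presentedMk E _ (.var ⟨i, x⟩), fun σ x =>
      (presentedMk_rel (.op i σ x)).trans (presentedMk_app _ _)⟩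

/-- `coproductCofan` is a coproduct. -/
noncomputable def coproductCofanIsColimit {I : Type u} (A : I → Variety E) :
    IsColimit (coproductCofan A) :=
  Cofan.IsColimit.mk _
    (fun t => presentedDesc (fun x => t.inj x.1 x.2) (by
      rintro _ _ ⟨i, σ, x⟩
      exact map_op (t.inj i) σ x))
    (fun _ _ => rfl)
    (fun _ _ h => presented_hom_ext fun x => congr_hom (h x.1) x.2)

instance : HasCoproducts.{u} (Variety E) :=
  hasCoproducts_of_colimit_cofans coproductCofan coproductCofanIsColimit

/-! ### Functors preserving intersections -/

section Intersections

variable {H : Variety E ⥤ Variety E}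

/-- If `d` is the intersection of the monomorphisms `m i`, then `H.map d` is the intersection of
the `H.map (m i)`. -/
theorem exists_lift_intersection (hH : PreservesIntersections H) {I : Type u} {A : I → Variety E}
    (m : ∀ i, A i ⟶ B) (hm : ∀ i, Function.Injective (m i)) (d : D ⟶ B)
    (hd : Function.Injective d) (p : ∀ i, D ⟶ A i) (hp : ∀ i, p i ≫ m i = d)
    (h : ∀ b, (∀ i, ∃ a, m i a = b) → ∃ x, d x = b) {Z : Variety E} (k : Z ⟶ H.obj B)
    (g : ∀ i, Z ⟶ H.obj (A i)) (hg : ∀ i, g i ≫ H.map (m i) = k) :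
    ∃ l : Z ⟶ H.obj D, l ≫ H.map d = k ∧ ∀ i, l ≫ H.map (p i) = g i := by
  have := hH I B A m fun i => mono_of_injective _ (hm i)
  let c : Cone (WidePullbackShape.wideCospan B A m) := WidePullbackShape.mkCone d p hp
  -- The leg of a cone into `B` has values in the image of every `m i`, hence in the image of `d`.
  have lift (s : Cone (WidePullbackShape.wideCospan B A m)) :
      ∃ l : s.pt ⟶ D, l ≫ d = s.π.app none := by
    refine exists_lift_of_injective d hd (s.π.app none) fun z => h _ fun i =>
      ⟨s.π.app (some i) z, ?_⟩
    exact congr_hom (s.w (WidePullbackShape.Hom.term i)) z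
  choose l hl using lift
  have hc : IsLimit c := by
    refine ⟨l, fun s j => ?_, fun s t ht => ?_⟩
    · rcases j with _ | i
      · exact hl s
      · have := mono_of_injective _ (hm i)
        refine (cancel_mono (m i)).1 ?_
        have h₁ : (l s ≫ p i) ≫ m i = s.π.app none := by rw [Category.assoc, hp, hl]
        exact h₁.trans (s.w (WidePullbackShape.Hom.term i)).symm
    · have := mono_of_injective _ hd
      exact (cancel_mono d).1 ((ht none).trans (hl s).symm)
  let s : Cone (WidePullbackShape.wideCospan B A m ⋙ H) := WidePullbackShape.mkCone k g hg
  exact ⟨(isLimitOfPreserves H hc).lift s, (isLimitOfPreserves H hc).fac s none,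
    fun i => (isLimitOfPreserves H hc).fac s (some i)⟩

/-- The intersection of `m` with itself is `m`, with identity projections. As `H` preserves it, two
maps that agree after `H.map m` are both equal to the induced map into the intersection. -/
theorem injective_map (hH : PreservesIntersections H) (m : A ⟶ B) (hm : Function.Injective m) :
    Function.Injective (H.map m) := by
  have : Mono (H.map m) := by
    refine ⟨fun {Z} f g w => ?_⟩
    obtain ⟨l, -, hl⟩ := exists_lift_intersection hH (I := ULift.{u} Bool) (fun _ => m)
      (fun _ => hm) m hm (fun _ => 𝟙 A) (fun _ => Category.id_comp m) (fun _ h => h ⟨true⟩)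
      (f ≫ H.map m) (fun i => if i.down then f else g) (by rintro ⟨_ | _⟩ <;> simp [w])
    exact (hl ⟨true⟩).symm.trans (hl ⟨false⟩)
  exact injective_of_mono _

end Intersections

end Variety
/-! ### Coalgebras over a variety -/

namespace VarietyCoalgebra

open Endofunctor Function Variety

variable {S : Signature.{u}} {E : Set S.Equation} {H : Variety E ⥤ Variety E}
  {A B D : Coalgebra H}

theorem map_str (f : A ⟶ B) (x : A.V) : H.map f.f (A.str x) = B.str (f.f x) :=
  congr_hom f.h x

theorem congr_hom {f g : A ⟶ B} (h : f = g) (x : A.V) : f.f x = g.f x := by rw [h]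

theorem comp_apply (f : A ⟶ B) (g : B ⟶ D) (x : A.V) : (f ≫ g).f x = g.f (f.f x) := rfl

theorem map_comp_apply {X Y Z : Variety E} (f : X ⟶ Y) (g : Y ⟶ Z) (x : H.obj X) :
    H.map (f ≫ g) x = H.map g (H.map f x) := by
  rw [H.map_comp]; rfl

theorem isIso_of_bijective (f : A ⟶ B) (hf : Bijective f.f) : IsIso f := by
  have := Variety.isIso_of_bijective f.f hf
  exact Coalgebra.iso_of_iso f

theorem bijective_of_isIso (f : A ⟶ B) [IsIso f] : Bijective f.f := by
  refine ⟨fun x y h => ?_, fun y => ⟨(inv f).f y, congr_hom (IsIso.inv_hom_id f) y⟩⟩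
  have key (x : A.V) : (inv f).f (f.f x) = x := congr_hom (IsIso.hom_inv_id f) x
  rw [← key x, h, key]

theorem isSimpleCoalgebra_iff :
    IsSimpleCoalgebra A ↔ ∀ (B : Coalgebra H) (e : A ⟶ B), Surjective e.f → Injective e.f := by
  refine ⟨fun h B e he => ?_, fun h B e he => ?_⟩
  · have := h B e (strongEpi_of_surjective _ he)
    exact (bijective_of_isIso e).1
  · have := surjective_of_strongEpi e.f
    exact isIso_of_bijective e ⟨h B e this, this⟩

/-- A factorization through a surjective coalgebra homomorphism is a coalgebra homomorphism. -/
theorem exists_hom_of_comp_eq (e : A ⟶ B) (he : Surjective e.f) (f : A ⟶ D) (g : B.V ⟶ D.V)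
    (h : e.f ≫ g = f.f) : ∃ g' : B ⟶ D, e ≫ g' = f := by
  have := epi_of_surjective e.f he
  refine ⟨⟨g, (cancel_epi e.f).1 ?_⟩, Coalgebra.ext h⟩
  rw [← Category.assoc, ← e.h, Category.assoc, ← H.map_comp, h, f.h, ← h, Category.assoc]

/-- Every coalgebra homomorphism is a surjective one followed by an injective one. -/
theorem exists_image (hH : PreservesIntersections H) (f : A ⟶ B) :
    ∃ (I : Coalgebra H) (e : A ⟶ I) (m : I ⟶ B),
      Surjective e.f ∧ Injective m.f ∧ e ≫ m = f := by
  obtain ⟨I, e, m, he, hm, hf⟩ := Variety.exists_image f.f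
  -- The structure on the image is a diagonal fill-in; it is well defined because `H.map m` is
  -- injective.
  obtain ⟨s, hs⟩ := exists_desc_of_surjective e he (A.str ≫ H.map e) fun x y h =>
    injective_map hH m hm <| by
      simp only [Variety.comp_apply, ← map_comp_apply, hf, map_str]
      rw [← hf, Variety.comp_apply, Variety.comp_apply, h]
  have := epi_of_surjective e he
  refine ⟨⟨I, s⟩, ⟨e, hs.symm⟩, ⟨m, (cancel_epi e).1 ?_⟩, he, hm, Coalgebra.ext hf⟩
  change e ≫ s ≫ H.map m = e ≫ m ≫ B.str
  rw [← Category.assoc, hs, Category.assoc, ← H.map_comp, hf, f.h, ← hf, Category.assoc]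

/-- A relation such that every quotient of the underlying algebra identifying related elements
also identifies their successors can be divided out. -/
theorem exists_quotient (A : Coalgebra H) (r : A.V → A.V → Prop)
    (hr : ∀ (Q : Variety E) (q : A.V ⟶ Q), (∀ x y, r x y → q x = q y) →
      ∀ x y, r x y → H.map q (A.str x) = H.map q (A.str y)) :
    ∃ (Q : Coalgebra H) (e : A ⟶ Q), Surjective e.f ∧ ∀ x y, r x y → e.f x = e.f y := by
  obtain ⟨Q, q, hq, hqr, hdesc⟩ := Variety.exists_quotient A.V r
  obtain ⟨s, hs⟩ := hdesc _ (A.str ≫ H.map q) (hr Q q hqr)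
  exact ⟨⟨Q, s⟩, ⟨q, hs.symm⟩, hq, hqr⟩

/-! ### Simple coalgebras -/

/-- Every coalgebra has a simple quotient. -/
theorem exists_isSimpleQuotient (A : Coalgebra H) :
    ∃ (B : Coalgebra H) (e : A ⟶ B), IsSimpleQuotient e := by
  -- Divide out all pairs identified by some quotient of `A`. A map `q` identifying them factors
  -- through each such quotient, so `H.map q` also identifies their successors.
  obtain ⟨B, e, he, hr⟩ := exists_quotient A
    (fun x y => ∃ (B : Coalgebra H) (e : A ⟶ B), Surjective e.f ∧ e.f x = e.f y) (by
      rintro Q q hq x y ⟨B, e, he, h⟩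
      obtain ⟨g, rfl⟩ := exists_desc_of_surjective e.f he q fun x y h => hq x y ⟨B, e, he, h⟩
      rw [map_comp_apply, map_comp_apply, map_str, map_str, h])
  refine ⟨B, e, strongEpi_of_surjective _ he, isSimpleCoalgebra_iff.2 fun D g hg b b' h => ?_⟩
  obtain ⟨x, rfl⟩ := he b
  obtain ⟨y, rfl⟩ := he b'
  -- A quotient of `B` is also a quotient of `A`, so what it identifies has already been divided
  -- out.
  exact hr x y ⟨D, e ≫ g, hg.comp he, h⟩

/-- Homomorphisms into a simple coalgebra factor through all quotients of the domain. -/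
theorem exists_factor_of_isSimpleCoalgebra (hB : IsSimpleCoalgebra B) (f : A ⟶ B) (e : A ⟶ D)
    (he : Surjective e.f) : ∃ g : D ⟶ B, e ≫ g = f := by
  -- Push `e` out along `f`. The result is a quotient of the simple `B`, so `q` is injective and `f`
  -- is already constant on the fibres of `e`.
  obtain ⟨Q, q, hq, hr⟩ := exists_quotient B
    (fun b b' => ∃ x y, e.f x = e.f y ∧ f.f x = b ∧ f.f y = b') (by
      rintro Q q hq _ _ ⟨x, y, h, rfl, rfl⟩
      obtain ⟨g, hg⟩ := exists_desc_of_surjective e.f he (f.f ≫ q) fun x y h =>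
        hq _ _ ⟨x, y, h, rfl, rfl⟩
      rw [← map_str, ← map_str, ← map_comp_apply, ← map_comp_apply, ← hg, map_comp_apply,
        map_comp_apply, map_str, map_str, h])
  obtain ⟨g, hg⟩ := exists_desc_of_surjective e.f he f.f fun x y h =>
    isSimpleCoalgebra_iff.1 hB Q q hq (hr _ _ ⟨x, y, h, rfl, rfl⟩)
  exact exists_hom_of_comp_eq e he f g hg

/-- The injection `m` factors through every quotient of `A`, which must then be injective. -/
theorem isSimpleCoalgebra_of_injective (hB : IsSimpleCoalgebra B) (m : A ⟶ B)
    (hm : Injective m.f) : IsSimpleCoalgebra A := by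
  refine isSimpleCoalgebra_iff.2 fun D e he => ?_
  obtain ⟨g, rfl⟩ := exists_factor_of_isSimpleCoalgebra hB m e he
  exact Injective.of_comp (f := g.f) hm

/-- The surjective part of the image factorization is a quotient of `A`, hence injective. -/
theorem injective_of_isSimpleCoalgebra (hH : PreservesIntersections H) (hA : IsSimpleCoalgebra A)
    (f : A ⟶ B) : Injective f.f := by
  obtain ⟨I, e, m, he, hm, rfl⟩ := exists_image hH f
  exact hm.comp (isSimpleCoalgebra_iff.1 hA I e he)

/-! ### Least subcoalgebras and coproducts -/

/-- Every element of a coalgebra is contained in a least subcoalgebra. -/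
theorem exists_isLeastSubcoalgebra (hH : PreservesIntersections H) (B : Coalgebra H) (y : B.V) :
    ∃ (A : Coalgebra H) (m : A ⟶ B), PointedCoalgebra.IsLeastSubcoalgebra m y := by
  -- Indexing by underlying subsets, not by subcoalgebras, keeps the intersection within the
  -- universe `u`.
  let I : Type u := {p : Set B.V // ∃ (A : Coalgebra H) (m : A ⟶ B),
    Injective m.f ∧ Set.range m.f = p ∧ y ∈ p}
  choose A m hm hrange hy using fun i : I => i.2
  let p : Set B.V := {b | ∀ i, ∃ a, (m i).f a = b}
  have hp (σ) (x : S.arity σ → B.V) (hx : ∀ j, x j ∈ p) : B.V.alg.op σ x ∈ p := by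
    intro i
    choose a ha using fun j => hx j i
    exact ⟨(A i).V.alg.op σ a, by rw [map_op]; simp only [ha]⟩
  let d : subalgebra B.V p hp ⟶ B.V := subalgebraInclusion B.V p hp
  have hd : Injective d := Subtype.val_injective
  choose π hπ using fun i => exists_lift_of_injective (m i).f (hm i) d fun z => z.2 i
  obtain ⟨s, hs, hs'⟩ := exists_lift_intersection hH (fun i => (m i).f) hm d hd π hπ
    (fun b hb => ⟨⟨b, hb⟩, rfl⟩) (d ≫ B.str) (fun i => π i ≫ (A i).str)
    (fun i => by rw [Category.assoc, (m i).h, ← Category.assoc, hπ])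
  refine ⟨⟨_, s⟩, ⟨d, hs⟩, mono_of_injective _ hd, ⟨⟨y, fun i => ?_⟩, rfl⟩, fun A' n hn hy' => ?_⟩
  · have := hy i
    rwa [← hrange i] at this
  · have hn := injective_of_mono n.f
    let i : I := ⟨Set.range n.f, A', n, hn, rfl, hy'⟩
    obtain ⟨g, hg⟩ := exists_lift_of_injective n.f hn d fun z => by
      have : d z ∈ Set.range (m i).f := z.2 i
      rwa [hrange i] at this
    have : Mono (H.map n.f) := mono_of_injective _ (injective_map hH _ hn)
    refine ⟨⟨g, (cancel_mono (H.map n.f)).1 ?_⟩, Coalgebra.ext hg⟩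
    rw [Category.assoc, Category.assoc, ← H.map_comp, hg, hs, n.h, ← Category.assoc, hg]

/-- Coproducts of coalgebras are formed in the base category. -/
theorem nonempty_isColimit_coproductCoalgebra {I : Type u} (A : I → Coalgebra H)
    (c : Cofan fun i => (A i).V) (hc : IsColimit c) :
    Nonempty (IsColimit (coproductCoalgebra A c hc)) := by
  let s : c.pt ⟶ H.obj c.pt := (coproductCoalgebra A c hc).pt.str
  have hs (i : I) : c.inj i ≫ s = (A i).str ≫ H.map (c.inj i) :=
    ((coproductCoalgebra A c hc).inj i).h.symm
  have hdesc (t : Cofan A) : ∃ d : c.pt ⟶ t.pt.V, ∀ i, c.inj i ≫ d = (t.inj i).f :=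
    ⟨Cofan.IsColimit.desc hc fun i => (t.inj i).f, Cofan.IsColimit.fac hc _⟩
  choose d hd using hdesc
  have hstr (t : Cofan A) : s ≫ H.map (d t) = d t ≫ t.pt.str := by
    refine Cofan.IsColimit.hom_ext hc _ _ fun i => ?_
    rw [← Category.assoc, hs, Category.assoc, ← H.map_comp, hd, (t.inj i).h, ← Category.assoc, hd]
  refine ⟨Cofan.IsColimit.mk _ (fun t => ⟨d t, hstr t⟩) (fun t i => Coalgebra.ext (hd t i))
    fun t f hf => Coalgebra.ext (Cofan.IsColimit.hom_ext hc _ _ fun i => ?_)⟩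
  exact (congrArg Coalgebra.Hom.f (hf i)).trans (hd t i).symm

end VarietyCoalgebra

/-! ### Well-pointed coalgebras -/

namespace PointedCoalgebra

open Endofunctor Function Variety VarietyCoalgebra

variable {S : Signature.{u}} {E : Set S.Equation} {H : Variety E ⥤ Variety E}

theorem isIso_of_bijective {P Q : PointedCoalgebra H} (f : P ⟶ Q) (hf : Bijective f.hom.f) :
    IsIso f := by
  have := VarietyCoalgebra.isIso_of_bijective f.hom hf
  have key (x : P.coalg.V) : (inv f.hom).f (f.hom.f x) = x :=
    VarietyCoalgebra.congr_hom (IsIso.hom_inv_id f.hom) x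
  refine ⟨⟨inv f.hom, by rw [← f.map_point, key]⟩, Hom.ext ?_, Hom.ext ?_⟩
  · exact IsIso.hom_inv_id f.hom
  · exact IsIso.inv_hom_id f.hom

theorem bijective_of_isIso {P Q : PointedCoalgebra H} (f : P ⟶ Q) [IsIso f] :
    Bijective f.hom.f := by
  have : IsIso f.hom := ⟨(inv f).hom, congrArg Hom.hom (IsIso.hom_inv_id f),
    congrArg Hom.hom (IsIso.inv_hom_id f)⟩
  exact VarietyCoalgebra.bijective_of_isIso f.hom

/-- A pointed coalgebra is well-pointed iff it is simple and generated by its point. -/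
theorem isWellPointed_iff {P : PointedCoalgebra H} :
    P.IsWellPointed ↔ IsSimpleCoalgebra P.coalg ∧
      ∀ (Q : PointedCoalgebra H) (m : Q ⟶ P), Injective m.hom.f → Surjective m.hom.f := by
  refine ⟨fun h => ⟨isSimpleCoalgebra_iff.2 fun B e he => ?_, fun Q m hm => ?_⟩,
    fun h => ⟨fun Q e he => ?_, fun Q m hm => ?_⟩⟩
  · let e' : P ⟶ ⟨B, e.f P.point⟩ := ⟨e, rfl⟩
    have := h.1 _ e' (strongEpi_of_surjective _ he)
    exact (bijective_of_isIso e').1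
  · have := h.2 Q m (mono_of_injective _ hm)
    exact (bijective_of_isIso m).2
  · have := surjective_of_strongEpi e.hom.f
    exact isIso_of_bijective e ⟨isSimpleCoalgebra_iff.1 h.1 _ e.hom this, this⟩
  · have := injective_of_mono m.hom.f
    exact isIso_of_bijective m ⟨this, h.2 Q m this⟩

/-- A well-pointed subcoalgebra receives an isomorphism from the least one containing its point. -/
theorem nonempty_iso_of_isLeastSubcoalgebra {P : PointedCoalgebra H} (hP : P.IsWellPointed)
    {A B : Coalgebra H} {m : P.coalg ⟶ B} (hm : Injective m.f) {l : A ⟶ B} {x : A.V}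
    (hl : IsLeastSubcoalgebra l (l.f x)) (hx : m.f P.point = l.f x) :
    Nonempty ((⟨A, x⟩ : PointedCoalgebra H) ≅ P) := by
  obtain ⟨hl, -, hl'⟩ := hl
  -- Leastness embeds `A` in `P` over `B`, point to point; `P` has no proper pointed subobject.
  obtain ⟨g, rfl⟩ := hl' P.coalg m (mono_of_injective _ hm) ⟨_, hx⟩
  have hg : Injective g.f := Injective.of_comp (f := m.f) (injective_of_mono (g ≫ m).f)
  let g' : (⟨A, x⟩ : PointedCoalgebra H) ⟶ P := ⟨g, hm hx.symm⟩
  have := isIso_of_bijective g' ⟨hg, (isWellPointed_iff.1 hP).2 _ g' hg⟩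
  exact ⟨asIso g'⟩

/-- Two well-pointed subcoalgebras with the same point are isomorphic. -/
theorem nonempty_iso_of_injective (hH : PreservesIntersections H) {P Q : PointedCoalgebra H}
    (hP : P.IsWellPointed) (hQ : Q.IsWellPointed) {B : Coalgebra H} {m : P.coalg ⟶ B}
    (hm : Injective m.f) {n : Q.coalg ⟶ B} (hn : Injective n.f) (h : m.f P.point = n.f Q.point) :
    Nonempty (P ≅ Q) := by
  obtain ⟨L, l, hl⟩ := exists_isLeastSubcoalgebra hH B (m.f P.point)
  obtain ⟨x, hx⟩ := hl.2.1
  rw [← hx] at hl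
  obtain ⟨i⟩ := nonempty_iso_of_isLeastSubcoalgebra hP hm hl hx.symm
  obtain ⟨j⟩ := nonempty_iso_of_isLeastSubcoalgebra hQ hn hl (h.symm.trans hx.symm)
  exact ⟨i.symm ≪≫ j⟩

/-- The least subcoalgebra of a simple coalgebra containing a given element is well-pointed. -/
theorem isWellPointed_of_isLeastSubcoalgebra {A B : Coalgebra H} (hB : IsSimpleCoalgebra B)
    {l : A ⟶ B} {x : A.V} (hl : IsLeastSubcoalgebra l (l.f x)) :
    (⟨A, x⟩ : PointedCoalgebra H).IsWellPointed := by
  obtain ⟨hl, -, hl'⟩ := hl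
  have hl := injective_of_mono l.f
  refine isWellPointed_iff.2 ⟨isSimpleCoalgebra_of_injective hB l hl, fun Q m hm a => ?_⟩
  obtain ⟨g, hg⟩ := hl' Q.coalg (m.hom ≫ l) (mono_of_injective _ (hl.comp hm))
    ⟨Q.point, congrArg l.f m.map_point⟩
  exact ⟨g.f a, hl (VarietyCoalgebra.congr_hom hg a)⟩

theorem IsLeastSubcoalgebra.comp_iso {A A' B : Coalgebra H} {m : A ⟶ B} {y : B.V}
    (h : IsLeastSubcoalgebra m y) (i : A' ≅ A) : IsLeastSubcoalgebra (i.hom ≫ m) y := by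
  obtain ⟨hm, ⟨x, hx⟩, hl⟩ := h
  have hi (x : A.V) : i.hom.f (i.inv.f x) = x := VarietyCoalgebra.congr_hom i.inv_hom_id x
  refine ⟨mono_of_injective _ ((injective_of_mono m.f).comp
    (VarietyCoalgebra.bijective_of_isIso i.hom).1), ⟨i.inv.f x, ?_⟩, fun A'' n hn hy => ?_⟩
  · rw [VarietyCoalgebra.comp_apply, hi, hx]
  · obtain ⟨g, hg⟩ := hl A'' n hn hy
    exact ⟨i.hom ≫ g, by rw [Category.assoc, hg]⟩

/-- The isomorphism of coalgebras underlying an isomorphism of pointed coalgebras. -/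
def coalgIso {P Q : PointedCoalgebra H} (i : P ≅ Q) : P.coalg ≅ Q.coalg :=
  ⟨i.hom.hom, i.inv.hom, congrArg Hom.hom i.hom_inv_id, congrArg Hom.hom i.inv_hom_id⟩

/-! ### Representatives and the maps `a⁺` -/

section Representatives

variable {T : Type u} {rep : T → PointedCoalgebra H}

/-- Every element of a simple coalgebra is the point of a least subcoalgebra carried by a
representative. -/
theorem exists_rep (hH : PreservesIntersections H) (hrep : RepresentsWellPointed rep)
    {B : Coalgebra H} (hB : IsSimpleCoalgebra B) (y : B.V) :
    ∃ (t : T) (m : (rep t).coalg ⟶ B), m.f (rep t).point = y ∧ IsLeastSubcoalgebra m y := by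
  obtain ⟨L, l, hl⟩ := exists_isLeastSubcoalgebra hH B y
  obtain ⟨x, rfl⟩ := hl.2.1
  obtain ⟨t, ⟨i⟩, -⟩ := hrep.2 _ (isWellPointed_of_isLeastSubcoalgebra hB hl)
  refine ⟨t, (coalgIso i.symm).hom ≫ l, ?_, hl.comp_iso _⟩
  exact congrArg l.f i.inv.map_point

theorem exists_isWellPointedModification (hH : PreservesIntersections H)
    (hrep : RepresentsWellPointed rep) (P : PointedCoalgebra H) :
    ∃ t, IsWellPointedModification P (rep t) := by
  obtain ⟨B, e, he⟩ := exists_isSimpleQuotient P.coalg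
  obtain ⟨t, m, hm, hl⟩ := exists_rep hH hrep he.2 (e.f P.point)
  exact ⟨t, B, e, m, he, hl, hm⟩

/-- A representative that is behaviourally equivalent to `P` is isomorphic to the modification
of `P`. -/
theorem IsWellPointedModification.eq_of_map_eq (hH : PreservesIntersections H)
    (hrep : RepresentsWellPointed rep) {P : PointedCoalgebra H} {t t' : T}
    (ht : IsWellPointedModification P (rep t)) {B : Coalgebra H} (f : P.coalg ⟶ B)
    (m : (rep t').coalg ⟶ B) (h : m.f (rep t').point = f.f P.point) : t = t' := by
  obtain ⟨D, e, l, ⟨he, hD⟩, hl, hpt⟩ := ht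
  -- In the simple quotient of `B`, `rep t` arrives through `D` and `rep t'` directly. Both maps are
  -- injective, as their domains are simple, and they send the points to the same element.
  obtain ⟨B', q, -, hB'⟩ := exists_isSimpleQuotient B
  obtain ⟨g, hg⟩ := exists_factor_of_isSimpleCoalgebra hB' (f ≫ q) e (surjective_of_strongEpi e.f)
  have hsimple (t : T) := (isWellPointed_iff.1 (hrep.1 t)).1
  obtain ⟨i⟩ := nonempty_iso_of_injective hH (hrep.1 t) (hrep.1 t') (m := l ≫ g) (n := m ≫ q)
    (injective_of_isSimpleCoalgebra hH (hsimple t) _)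
    (injective_of_isSimpleCoalgebra hH (hsimple t') _) (by
      rw [VarietyCoalgebra.comp_apply, VarietyCoalgebra.comp_apply, hpt, h]
      exact VarietyCoalgebra.congr_hom hg P.point)
  obtain ⟨_, -, huniq⟩ := hrep.2 _ (hrep.1 t)
  exact (huniq t ⟨Iso.refl _⟩).trans (huniq t' ⟨i⟩).symm

/-- The map `a⁺ : A → T` with `a⁺ x = wp (A, a, x)`. -/
noncomputable def wp (hH : PreservesIntersections H) (hrep : RepresentsWellPointed rep)
    (A : Coalgebra H) (x : A.V) : T :=
  (exists_isWellPointedModification hH hrep ⟨A, x⟩).choose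

variable (hH : PreservesIntersections H) (hrep : RepresentsWellPointed rep)

theorem isWellPointedModification_wp (A : Coalgebra H) (x : A.V) :
    IsWellPointedModification ⟨A, x⟩ (rep (wp hH hrep A x)) :=
  (exists_isWellPointedModification hH hrep ⟨A, x⟩).choose_spec

/-- The working criterion for computing `wp`: any coalgebra in which the two points meet will do. -/
theorem wp_eq_of_map_eq {A B : Coalgebra H} {x : A.V} {t : T} (f : A ⟶ B)
    (m : (rep t).coalg ⟶ B) (h : m.f (rep t).point = f.f x) : wp hH hrep A x = t :=
  (isWellPointedModification_wp hH hrep A x).eq_of_map_eq hH hrep f m h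

theorem isWellPointedModification_iff (A : Coalgebra H) (x : A.V) (t : T) :
    IsWellPointedModification ⟨A, x⟩ (rep t) ↔ wp hH hrep A x = t := by
  refine ⟨?_, ?_⟩
  · rintro ⟨B, e, m, -, -, h⟩
    exact wp_eq_of_map_eq hH hrep e m h
  · rintro rfl
    exact isWellPointedModification_wp hH hrep A x

/-- Coalgebra homomorphisms preserve well-pointed modifications. -/
theorem wp_map {A B : Coalgebra H} (f : A ⟶ B) (x : A.V) :
    wp hH hrep B (f.f x) = wp hH hrep A x := by
  obtain ⟨D, e, m, -, -, h⟩ := isWellPointedModification_wp hH hrep B (f.f x)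
  exact (wp_eq_of_map_eq hH hrep (f ≫ e) m h).symm

theorem wp_point (t : T) : wp hH hrep (rep t).coalg (rep t).point = t :=
  wp_eq_of_map_eq hH hrep (𝟙 _) (𝟙 _) rfl

theorem exists_hom_rep_wp {B : Coalgebra H} (hB : IsSimpleCoalgebra B) (y : B.V) :
    ∃ m : (rep (wp hH hrep B y)).coalg ⟶ B, m.f (rep (wp hH hrep B y)).point = y := by
  obtain ⟨t, m, hm, -⟩ := exists_rep hH hrep hB y
  obtain rfl := wp_eq_of_map_eq hH hrep (x := y) (𝟙 B) m hm
  exact ⟨m, hm⟩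

/-! ### The algebra of well-pointed coalgebras -/

/-- In a coproduct of coalgebras, the modification of the value of an operation depends only on
the modifications of the arguments. -/
theorem wp_coproduct_op {σ : S.Op} {A : Coalgebra H} (x : S.arity σ → A.V)
    {t : S.arity σ → T} (ht : ∀ i, wp hH hrep A (x i) = t i)
    (c : Cofan fun i => (rep (t i)).coalg.V) (hc : IsColimit c) :
    wp hH hrep (coproductCoalgebra (fun i => (rep (t i)).coalg) c hc).pt
      (c.pt.alg.op σ fun i => c.inj i (rep (t i)).point) = wp hH hrep A (A.V.alg.op σ x) := by
  obtain ⟨B, q, -, hB⟩ := exists_isSimpleQuotient A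
  -- The simple quotient of `A` contains a copy of each argument's modification, with the argument's
  -- image as its point. Copairing these maps compares the coproduct with `A`.
  have key (i) : ∃ m : (rep (t i)).coalg ⟶ B, m.f (rep (t i)).point = q.f (x i) := by
    rw [← ht, ← wp_map hH hrep q]
    exact exists_hom_rep_wp hH hrep hB _
  choose m hm using key
  obtain ⟨hc'⟩ := nonempty_isColimit_coproductCoalgebra (fun i => (rep (t i)).coalg) c hc
  let f := Cofan.IsColimit.desc hc' m
  have hf (i) (z) : f.f (c.inj i z) = (m i).f z :=
    VarietyCoalgebra.congr_hom (Cofan.IsColimit.fac hc' m i) z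
  refine (wp_map hH hrep f _).symm.trans (Eq.trans ?_ (wp_map hH hrep q _))
  refine congrArg _ ((map_op f.f σ _).trans (Eq.trans ?_ (map_op q.f σ _).symm))
  simp only [hf, hm]

/-- The coproduct of the coalgebras in a family of representatives. -/
noncomputable def repCoproduct (rep : T → PointedCoalgebra H) {I : Type u} (t : I → T) :
    Cofan fun i => (rep (t i)).coalg :=
  coproductCoalgebra (fun i => (rep (t i)).coalg) _ (coproductCofanIsColimit _)

/-- The `Σ`-algebra of well-pointed coalgebras. -/
noncomputable def wpAlgebra : S.Algebra T where
  op σ t := wp hH hrep (repCoproduct rep t).pt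
    ((repCoproduct rep t).pt.V.alg.op σ fun i => ((repCoproduct rep t).inj i).f (rep (t i)).point)

theorem wp_op (A : Coalgebra H) (σ : S.Op) (x : S.arity σ → A.V) :
    wp hH hrep A (A.V.alg.op σ x) = (wpAlgebra hH hrep).op σ fun i => wp hH hrep A (x i) :=
  (wp_coproduct_op hH hrep x (fun _ => rfl) _ (coproductCofanIsColimit _)).symm

theorem wp_repCoproduct {I : Type u} (t : I → T) (i : I) :
    wp hH hrep (repCoproduct rep t).pt (((repCoproduct rep t).inj i).f (rep (t i)).point) =
      t i := by
  rw [wp_map, wp_point]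

/-- An assignment in `T` lifts along `a⁺` to the coproduct of the representatives indexed by the
variables, which satisfies `E`. -/
theorem wpAlgebra_satisfies : (wpAlgebra hH hrep).Satisfies E := by
  intro e he ρ
  have key (s : S.Term e.Var) := Signature.Term.eval_map (β := wpAlgebra hH hrep)
    (wp hH hrep (repCoproduct rep ρ).pt) (wp_op hH hrep _)
    (fun v => ((repCoproduct rep ρ).inj v).f (rep (ρ v)).point) s
  simp only [wp_repCoproduct] at key
  rw [← key, ← key, (repCoproduct rep ρ).pt.V.sat e he]

/-- The algebra of well-pointed coalgebras as an object of the variety. -/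
noncomputable def wpVariety : Variety E := ⟨T, wpAlgebra hH hrep, wpAlgebra_satisfies hH hrep⟩

/-- The map `a⁺` as a homomorphism. -/
noncomputable def wpHom (A : Coalgebra H) : A.V ⟶ wpVariety hH hrep :=
  ⟨wp hH hrep A, wp_op hH hrep A⟩

theorem comp_wpHom {A B : Coalgebra H} (f : A ⟶ B) :
    f.f ≫ wpHom hH hrep B = wpHom hH hrep A :=
  Variety.hom_ext fun x => wp_map hH hrep f x

/-! ### The final coalgebra -/

/-- The underlying function of the structure map of the coalgebra of well-pointed coalgebras. -/
noncomputable def wpStrFun (t : T) : H.obj (wpVariety hH hrep) :=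
  H.map (wpHom hH hrep (rep t).coalg) ((rep t).coalg.str (rep t).point)

/-- This is `τ ∘ a⁺ = H a⁺ ∘ a`. Both `A` and the modification map to the simple quotient, where the
points coincide, and `a⁺` is compatible with these maps. -/
theorem wpStrFun_wp (A : Coalgebra H) (x : A.V) :
    wpStrFun hH hrep (wp hH hrep A x) = H.map (wpHom hH hrep A) (A.str x) := by
  obtain ⟨B, q, m, -, -, h⟩ := isWellPointedModification_wp hH hrep A x
  rw [wpStrFun, ← comp_wpHom hH hrep m, ← comp_wpHom hH hrep q, map_comp_apply, map_comp_apply,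
    map_str, map_str, h]

/-- The coalgebra of well-pointed coalgebras. -/
noncomputable def wpCoalgebra : Coalgebra H where
  V := wpVariety hH hrep
  str := ⟨wpStrFun hH hrep, fun σ t => by
    have h := wpStrFun_wp hH hrep (repCoproduct rep t).pt
    -- By definition the value of an operation is a value of `a⁺` on the coproduct, where the
    -- structure map is a homomorphism.
    change wpStrFun hH hrep (wp hH hrep _ _) = _
    rw [h, map_op, map_op]
    congr 1
    funext i
    exact (h _).symm.trans (congrArg _ (wp_repCoproduct hH hrep t i))⟩

/-- The map `a⁺` as a coalgebra homomorphism. -/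
noncomputable def toWpCoalgebra (A : Coalgebra H) : A ⟶ wpCoalgebra hH hrep where
  f := wpHom hH hrep A
  h := Variety.hom_ext fun x => (wpStrFun_wp hH hrep A x).symm

/-- Each `t` is the image of the point of `rep t` under a homomorphism to `T`, and `wp` is
invariant. Uniqueness in finality rests on this. -/
theorem wp_wpCoalgebra (t : T) : wp hH hrep (wpCoalgebra hH hrep) t = t := by
  have h := wp_map hH hrep (toWpCoalgebra hH hrep (rep t).coalg) (rep t).point
  have h' : (toWpCoalgebra hH hrep (rep t).coalg).f (rep t).point = t := wp_point hH hrep t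
  rwa [h', wp_point] at h

/-- The coalgebra of well-pointed coalgebras is final. -/
noncomputable def wpCoalgebraIsTerminal : IsTerminal (wpCoalgebra hH hrep) :=
  IsTerminal.ofUniqueHom (toWpCoalgebra hH hrep) fun _ f =>
    Coalgebra.ext <| Variety.hom_ext fun x =>
      (wp_wpCoalgebra hH hrep (f.f x)).symm.trans (wp_map hH hrep f x)

end Representatives

end PointedCoalgebra

theorem mainTheorem8 {S : Signature.{u}} (E : Set S.Equation) (H : Variety E ⥤ Variety E)
    (hH : PreservesIntersections H) (T : Type u) (rep : T → PointedCoalgebra H)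
    (hrep : PointedCoalgebra.RepresentsWellPointed rep) :
    -- the functions `a⁺ : A → T` with `a⁺ x = wp (A, a, x)` are well defined
    ∃ plus : ∀ A : Endofunctor.Coalgebra H, A.V → T,
      (∀ (A : Endofunctor.Coalgebra H) (x : A.V) (t : T),
        PointedCoalgebra.IsWellPointedModification ⟨A, x⟩ (rep t) ↔ plus A x = t) ∧
    -- `T` is a `Σ`-algebra with operations computed on coproducts of coalgebras
    ∃ algT : S.Algebra T,
      (∀ (σ : S.Op) (t : S.arity σ → T),
        HasCoproduct (fun i => (rep (t i)).coalg.V) ∧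
        ∀ (c : Cofan (fun i => (rep (t i)).coalg.V)) (hc : IsColimit c),
          Nonempty (IsColimit (coproductCoalgebra (fun i => (rep (t i)).coalg) c hc)) ∧
          algT.op σ t =
            plus (coproductCoalgebra (fun i => (rep (t i)).coalg) c hc).pt
              (c.pt.alg.op σ (fun i => c.inj i (rep (t i)).point))) ∧
    -- `T` lies in the variety
    ∃ hT : algT.Satisfies E,
    -- every `a⁺` is a `Σ`-homomorphism
    ∃ plusHom : ∀ A : Endofunctor.Coalgebra H, A.V ⟶ (⟨T, algT, hT⟩ : Variety E),
      (∀ (A : Endofunctor.Coalgebra H) (x : A.V), plusHom A x = plus A x) ∧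
    -- `τ (A, a, x) = H a⁺ (a x)` is a `Σ`-homomorphism and `(T, τ)` is final
    ∃ τ : (⟨T, algT, hT⟩ : Variety E) ⟶ H.obj ⟨T, algT, hT⟩,
      (∀ t : T, τ t = H.map (plusHom (rep t).coalg) ((rep t).coalg.str (rep t).point)) ∧
      Nonempty (IsTerminal (⟨⟨T, algT, hT⟩, τ⟩ : Endofunctor.Coalgebra H)) := by
  refine ⟨PointedCoalgebra.wp hH hrep, PointedCoalgebra.isWellPointedModification_iff hH hrep,
    PointedCoalgebra.wpAlgebra hH hrep, fun σ t => ⟨inferInstance, fun c hc =>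
      ⟨VarietyCoalgebra.nonempty_isColimit_coproductCoalgebra _ c hc, ?_⟩⟩,
    PointedCoalgebra.wpAlgebra_satisfies hH hrep, PointedCoalgebra.wpHom hH hrep,
    fun _ _ => rfl, (PointedCoalgebra.wpCoalgebra hH hrep).str, fun _ => rfl,
    ⟨PointedCoalgebra.wpCoalgebraIsTerminal hH hrep⟩⟩
  -- Independence of the coproduct: the arbitrary `c` is compared with the coproduct chosen in
  -- `wpAlgebra`, which plays the role of `A`.
  exact (PointedCoalgebra.wp_coproduct_op hH hrep _
    (PointedCoalgebra.wp_repCoproduct hH hrep t) c hc).symm
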